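/- Let $X$ be a real random variable whose distribution is not concentrated at a single point, with characteristic function $\phi(t)=E\,e^{itX}$. Suppose $X$ is stable with index $\alpha>0$, $\alpha\neq 1$: for every positive integer $n$ there is a real $b_n$ such that the sum of $n$ independent copies of $X$ has the same distribution as $n^{1/\alpha}X+b_n$. Then there are real constants $\gamma$, $c>0$ and $c'$ such that $$\log\phi(t)= i\gamma t-c|t|^{\alpha}\bigl(1-ic'\,\mathrm{sign}(t)\bigr)\qquad\text{for all real } t,\tag{1}$$ where $\mathrm{sign}(t)$ is $1$, $0$, $-1$ according to whether $t>0$, $t=0$, $t<0$, and $\log\phi$ is the continuous logarithm of $\phi$ with $\log\phi(0)=0$ (that is, $\phi$ is the exponential of the right side of (1)). Moreover, for any real $\gamma, c, c'$ such that (1) holds, $c>0$ and - if $0<\alpha<2$, then $c'=\beta\tan(\pi\alpha/2)$ for some real $\beta$ with $-1\le\beta\le 1$; - if $\alpha=2$, then $c'=0$. -/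

import Mathlib

open MeasureTheory

/-- The law of `X₁ + ⋯ + Xₙ` for independent random variables `X₁, …, Xₙ`, each with law `μ`. -/
noncomputable def iidSumLaw (μ : Measure ℝ) (n : ℕ) : Measure ℝ :=
  (Measure.pi fun _ : Fin n => μ).map fun x => ∑ i, x i

/-- `μ` is stable with norming constants `a n > 0` and centering constants `b n`: for `X` with
law `μ` and every positive integer `n`, the sum of `n` independent copies of `X` has the same
distribution as `a n * X + b n`. -/
def IsStableWith (μ : Measure ℝ) (a b : ℕ → ℝ) : Prop :=
  ∀ n : ℕ, 1 ≤ n → 0 < a n ∧ iidSumLaw μ n = μ.map fun x => a n * x + b n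

/-- `μ` is a stable law with index `α > 0`: the norming constants are `n ^ (1 / α)`. -/
def IsStableWithIndex (μ : Measure ℝ) (α : ℝ) : Prop :=
  0 < α ∧ ∃ a b : ℕ → ℝ, IsStableWith μ a b ∧ ∀ n : ℕ, 1 ≤ n → a n = (n : ℝ) ^ (1 / α)

/-- The law `μ` is degenerate: concentrated at a single point. -/
def IsDegenerate (μ : Measure ℝ) : Prop :=
  ∃ x : ℝ, μ = Measure.dirac x

/-- The exponent `i γ t - c |t| ^ α (1 - i c' sign t)`. -/
noncomputable def stableExponent (α γ c c' t : ℝ) : ℂ :=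
  Complex.I * γ * t - c * ((|t| ^ α : ℝ) : ℂ) * (1 - Complex.I * c' * (Real.sign t : ℝ))

/-- `log φ(t) = i γ t - c |t| ^ α (1 - i c' sign t)` for all real `t`, where `φ` is the
characteristic function of `μ`. For `α > 0` the right side is continuous in `t` and vanishes at
`t = 0`, so this says that it is the continuous logarithm of `φ` that vanishes at `0`. -/
def HasStableRepresentation (μ : Measure ℝ) (α γ c c' : ℝ) : Prop :=
  ∀ t : ℝ, charFun μ t = Complex.exp (stableExponent α γ c c' t)

/-! Stability makes `φ` zero-free, so it has a continuous logarithm `ψ` with `n ψ(t) = ψ(n^(1/α) t)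
+ i b_n t`. As `α ≠ 1`, evaluating at `2` and `n` in both orders forces `b_n = γ (n - n^(1/α))`.
Then `w(t) = ψ(t) - iγt` scales exactly, hence is a power on `t > 0` (`eq_rpow_mul_of_nat_scaling`);
conjugation gives `t < 0`.

The bound on `c'` comes from positivity. For `Im p > 0`, the mean of `Im p * x² / |x - p|²` is
nonnegative, and it can be written through the Laplace transform of the characteristic function.
Apply this to the law of `n^(-1/α) (X - γ)`, multiply by `n` and let `n → ∞`: only the Laplace
transform of `t^α`, a multiple of `(-ip)^(-α-1)`, remains. Letting `p` tend to `1` and `-1` gives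
`|c' cos(πα/2)| ≤ sin(πα/2)`. -/

theorem eq_zero_of_exp_eq_one {f : ℝ → ℂ} (hf : Continuous f) (h0 : f 0 = 0)
    (h : ∀ t, Complex.exp (f t) = 1) (t : ℝ) : f t = 0 := by
  have key := Complex.isCoveringMapOn_exp.existsUnique_continuousMap_lifts
    (A := ℝ) (ContinuousMap.const ℝ (1 : ℂ)) (a₀ := 0) (e₀ := 0) (by simp) (by simp)
  have := key.unique (y₁ := ⟨f, hf⟩) (y₂ := ContinuousMap.const ℝ 0)
    ⟨h0, by ext t; simp [h]⟩ ⟨rfl, by ext t; simp⟩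
  exact congrArg (fun F : C(ℝ, ℂ) => F t) this

theorem exists_continuous_log {f : ℝ → ℂ} (hf : Continuous f) (h0 : f 0 = 1)
    (h : ∀ t, f t ≠ 0) :
    ∃ ψ : ℝ → ℂ, Continuous ψ ∧ ψ 0 = 0 ∧ ∀ t, Complex.exp (ψ t) = f t := by
  obtain ⟨F, ⟨hF0, hF⟩, -⟩ := Complex.isCoveringMapOn_exp.existsUnique_continuousMap_lifts
    (A := ℝ) ⟨f, hf⟩ (a₀ := 0) (e₀ := 0) (by simp [h0]) (by simpa using h)
  exact ⟨F, F.continuous, hF0, fun t => congrFun hF t⟩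

/-- A continuous `w : ℝ → ℂ` with `n * w t = w (n ^ h * t)` for all positive integers `n` is a
power function on the positive half-line. -/
theorem eq_rpow_mul_of_nat_scaling {w : ℝ → ℂ} (hw : Continuous w) {α : ℝ} (hα : 0 < α)
    (h : ∀ n : ℕ, 1 ≤ n → ∀ t, n * w t = w ((n : ℝ) ^ (1 / α) * t)) {t : ℝ} (ht : 0 < t) :
    w t = ((t ^ α : ℝ) : ℂ) * w 1 := by
  have hα' : α ≠ 0 := hα.ne'
  have hq : ∀ q : ℚ, 0 < q → w ((q : ℝ) ^ (1 / α)) = ((q : ℝ) : ℂ) * w 1 := by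
    intro q hq
    have hd : (0 : ℝ) < q.den := by exact_mod_cast q.den_pos
    obtain ⟨m, hm⟩ : ∃ m : ℕ, q.num = m := ⟨q.num.toNat, by
      have := Rat.num_pos.2 hq; omega⟩
    have hm1 : 1 ≤ m := by have := Rat.num_pos.2 hq; omega
    have hqe : (q : ℝ) = m / q.den := by
      rw [Rat.cast_def, hm]; simp
    -- For `q = m / d`, scaling `q^(1/α)` by `d` and `1` by `m` reaches the same point `m^(1/α)`.
    have e1 := h q.den q.den_pos ((q : ℝ) ^ (1 / α))
    have e2 := h m hm1 1
    have hq0 : (0 : ℝ) ≤ q := by exact_mod_cast hq.le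
    rw [← Real.mul_rpow hd.le hq0, show (q.den : ℝ) * q = m by rw [hqe]; field_simp] at e1
    rw [mul_one] at e2
    rw [← e2] at e1
    have hdc : (q.den : ℂ) ≠ 0 := by exact_mod_cast hd.ne'
    apply mul_left_cancel₀ hdc
    rw [e1, hqe]; push_cast; field_simp
  have hs : ∀ s ∈ Set.Ioi (0 : ℝ), w (s ^ (1 / α)) = (s : ℂ) * w 1 := by
    have hcl : closure (Set.Ioi (0 : ℝ) ∩ Set.range ((↑) : ℚ → ℝ)) ⊇ Set.Ioi 0 :=
      Rat.denseRange_cast.open_subset_closure_inter isOpen_Ioi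
    have : Set.EqOn (fun s : ℝ => w (s ^ (1 / α))) (fun s : ℝ => (s : ℂ) * w 1)
        (Set.Ioi (0 : ℝ) ∩ Set.range ((↑) : ℚ → ℝ)) := by
      rintro _ ⟨hx, q, rfl⟩
      exact hq q (by simpa using hx)
    have hc : Continuous fun s : ℝ => w (s ^ (1 / α)) :=
      hw.comp (Real.continuous_rpow_const (by positivity))
    intro s hs
    exact this.closure hc (by fun_prop) (hcl hs)
  have := hs (t ^ α) (Real.rpow_pos_of_pos ht α)
  rwa [← Real.rpow_mul ht.le, mul_one_div_cancel hα', Real.rpow_one] at this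

/-- Symmetrize: for an independent copy `X'`, `X - X'` has characteristic function `|φ|² = 1`, so `X
= X'` almost surely; by Fubini, fix a value of one of them. -/
theorem isDegenerate_of_norm_charFun_eq_one (μ : Measure ℝ) [IsProbabilityMeasure μ]
    (h : ∀ t, ‖charFun μ t‖ = 1) : IsDegenerate μ := by
  have h1 : (μ.prod (μ.map (fun x => (-1 : ℝ) * x))).map (fun p => p.1 + p.2)
      = Measure.dirac 0 := by
    have : IsProbabilityMeasure (μ.map (fun x => (-1 : ℝ) * x)) :=
      Measure.isProbabilityMeasure_map (by fun_prop)
    have : IsProbabilityMeasure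
        ((μ.prod (μ.map (fun x => (-1 : ℝ) * x))).map (fun p => p.1 + p.2)) :=
      Measure.isProbabilityMeasure_map (by fun_prop)
    apply Measure.ext_of_charFun
    ext t
    rw [ProbabilityTheory.charFun_map_add_prod_eq_mul, Pi.mul_apply, charFun_map_mul, charFun_dirac,
      neg_one_mul, charFun_neg, Complex.mul_conj, Complex.normSq_eq_norm_sq, h]
    simp
  have hm : MeasurableSet {z : ℝ | z = 0} := measurableSet_singleton 0
  have h2 : ∀ᵐ z ∂(Measure.dirac (0 : ℝ)), z = 0 := by
    rw [ae_dirac_iff hm]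
  rw [← h1, ae_map_iff (by fun_prop) hm] at h2
  have h3 := Measure.ae_ae_of_ae_prod h2
  obtain ⟨x, hx⟩ := h3.exists
  rw [ae_map_iff (by fun_prop) (measurableSet_eq_fun (by fun_prop) (by fun_prop))] at hx
  refine ⟨x, ?_⟩
  have hx' : (fun y : ℝ => y) =ᵐ[μ] fun _ => x := by
    filter_upwards [hx] with y hy
    linarith
  have : μ.map (fun y : ℝ => y) = μ.map fun _ => x := Measure.map_congr hx'
  rwa [Measure.map_id', Measure.map_const, measure_univ, one_smul] at this

/-! ### Characteristic functions of stable laws -/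

theorem charFun_iidSumLaw (μ : Measure ℝ) [IsProbabilityMeasure μ] (n : ℕ) (t : ℝ) :
    charFun (iidSumLaw μ n) t = charFun μ t ^ n := by
  rw [iidSumLaw, ProbabilityTheory.charFun_map_sum_pi_eq_prod]
  simp

theorem charFun_map_affine (μ : Measure ℝ) (a b t : ℝ) :
    charFun (μ.map fun x => a * x + b) t =
      charFun μ (a * t) * Complex.exp (Complex.I * b * t) := by
  have : (fun x : ℝ => a * x + b) = (fun x => x + b) ∘ (fun x => a * x) := rfl
  rw [this, ← Measure.map_map (by fun_prop) (by fun_prop), charFun_map_add_const, charFun_map_mul]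
  simp [mul_comm, mul_left_comm]

theorem charFun_pow_of_isStableWith {μ : Measure ℝ} [IsProbabilityMeasure μ] {a b : ℕ → ℝ}
    (h : IsStableWith μ a b) {n : ℕ} (hn : 1 ≤ n) (t : ℝ) :
    charFun μ t ^ n = charFun μ (a n * t) * Complex.exp (Complex.I * b n * t) := by
  rw [← charFun_iidSumLaw, (h n hn).2, charFun_map_affine]

/-- A zero at `t` would give zeros at `n^(-1/α) t` for all `n ≥ 1`, which tend to `0`, where `φ =
1`. -/
theorem charFun_ne_zero_of_stable {μ : Measure ℝ} [IsProbabilityMeasure μ] {α : ℝ} (hα : 0 < α)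
    {b : ℕ → ℝ} (h : IsStableWith μ (fun n => (n : ℝ) ^ (1 / α)) b) (t : ℝ) :
    charFun μ t ≠ 0 := by
  intro h0
  have hz : ∀ n : ℕ, charFun μ (((n : ℝ) + 1) ^ (-(1 / α)) * t) = 0 := by
    intro n
    have hp : (0 : ℝ) < (n : ℝ) + 1 := by positivity
    have := charFun_pow_of_isStableWith h (Nat.le_add_left 1 n) (((n : ℝ) + 1) ^ (-(1 / α)) * t)
    rw [← mul_assoc, Nat.cast_add_one, ← Real.rpow_add hp, add_neg_cancel, Real.rpow_zero, one_mul,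
      h0, zero_mul] at this
    exact eq_zero_of_pow_eq_zero this
  have hl : Filter.Tendsto (fun n : ℕ => ((n : ℝ) + 1) ^ (-(1 / α)) * t) Filter.atTop (nhds 0) := by
    have h1 := (tendsto_rpow_neg_atTop (y := 1 / α) (by positivity)).comp
      (Filter.tendsto_atTop_add_const_right _ (1 : ℝ) tendsto_natCast_atTop_atTop)
    simpa using h1.mul_const t
  have h2 := ((continuous_charFun (μ := μ)).tendsto 0).comp hl
  rw [charFun_zero, probReal_univ] at h2
  have h3 : (charFun μ ∘ fun n : ℕ => ((n : ℝ) + 1) ^ (-(1 / α)) * t) = fun _ => 0 :=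
    funext hz
  rw [h3] at h2
  have := tendsto_nhds_unique h2 tendsto_const_nhds
  simp at this

theorem exists_log_scaling {μ : Measure ℝ} [IsProbabilityMeasure μ] {α : ℝ} (hα : 0 < α)
    {b : ℕ → ℝ} (h : IsStableWith μ (fun n => (n : ℝ) ^ (1 / α)) b) :
    ∃ ψ : ℝ → ℂ, Continuous ψ ∧ (∀ t, Complex.exp (ψ t) = charFun μ t) ∧
      (∀ t, ψ (-t) = (starRingEnd ℂ) (ψ t)) ∧
      ∀ n : ℕ, 1 ≤ n → ∀ t, n * ψ t = ψ ((n : ℝ) ^ (1 / α) * t) + Complex.I * b n * t := by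
  obtain ⟨ψ, hc, h0, he⟩ := exists_continuous_log (continuous_charFun (μ := μ)) (by simp)
    (charFun_ne_zero_of_stable hα h)
  refine ⟨ψ, hc, he, fun t => ?_, fun n hn t => ?_⟩
  · have := eq_zero_of_exp_eq_one (f := fun t => ψ (-t) - (starRingEnd ℂ) (ψ t))
      (by fun_prop) (by simp [h0]) (fun t => by
        rw [Complex.exp_sub, Complex.exp_conj, he, he, charFun_neg, div_self]
        simpa using charFun_ne_zero_of_stable hα h t) t
    exact sub_eq_zero.1 this
  · have := eq_zero_of_exp_eq_one
      (f := fun t => n * ψ t - (ψ ((n : ℝ) ^ (1 / α) * t) + Complex.I * b n * t))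
      (by fun_prop) (by simp [h0]) (fun t => by
        rw [Complex.exp_sub, Complex.exp_nat_mul, Complex.exp_add, he, he,
          charFun_pow_of_isStableWith h hn, div_self]
        exact mul_ne_zero (charFun_ne_zero_of_stable hα h _) (Complex.exp_ne_zero _)) t
    exact sub_eq_zero.1 this

/-- For index `α ≠ 1` the centering constants of a stable law are `γ * (n - n ^ (1 / α))`. -/
theorem exists_centering_of_log_scaling {ψ : ℝ → ℂ} {α : ℝ} (hα : 0 < α) (hα1 : α ≠ 1) {b : ℕ → ℝ}
    (h : ∀ n : ℕ, 1 ≤ n → ∀ t : ℝ,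
      n * ψ t = ψ ((n : ℝ) ^ (1 / α) * t) + Complex.I * b n * t) :
    ∃ γ : ℝ, ∀ n : ℕ, 1 ≤ n → b n = γ * (n - (n : ℝ) ^ (1 / α)) := by
  -- The only use of `α ≠ 1`: `γ` is determined by dividing `b 2` by this number.
  have hne : (2 : ℝ) - 2 ^ (1 / α) ≠ 0 := by
    intro h2
    have h3 : (2 : ℝ) ^ (1 : ℝ) = 2 ^ (1 / α) := by rw [Real.rpow_one]; linarith
    have h4 := (Real.rpow_right_inj (by norm_num) (by norm_num)).1 h3
    apply hα1
    field_simp at h4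
    exact h4
  refine ⟨b 2 / (2 - 2 ^ (1 / α)), fun n hn => ?_⟩
  have e1 := h 2 (by norm_num) 1
  have e2 := h n hn ((2 : ℝ) ^ (1 / α))
  have e3 := h n hn 1
  have e4 := h 2 (by norm_num) ((n : ℝ) ^ (1 / α))
  rw [mul_comm ((n : ℝ) ^ (1 / α))] at e2
  push_cast at e1 e2 e3 e4
  simp only [mul_one] at e1 e2 e3 e4
  have e5 : Complex.I * ((n * b 2 + b n * 2 ^ (1 / α) : ℝ) : ℂ)
      = Complex.I * ((2 * b n + b 2 * (n : ℝ) ^ (1 / α) : ℝ) : ℂ) := by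
    push_cast [Complex.ofReal_cpow]
    linear_combination -(n : ℂ) * e1 - e2 + 2 * e3 + e4
  have e6 := Complex.ofReal_injective (mul_left_cancel₀ Complex.I_ne_zero e5)
  field_simp
  linarith

/-! ### The stable exponent and existence of the representation -/

theorem stableExponent_of_pos {α γ c c' t : ℝ} (ht : 0 < t) :
    stableExponent α γ c c' t
      = Complex.I * γ * t - c * ((t ^ α : ℝ) : ℂ) * (1 - Complex.I * c') := by
  simp [stableExponent, abs_of_pos ht, Real.sign_of_pos ht]

theorem stableExponent_neg (α γ c c' t : ℝ) :
    stableExponent α γ c c' (-t) = (starRingEnd ℂ) (stableExponent α γ c c' t) := by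
  simp [stableExponent, Real.sign_neg]

theorem stableExponent_zero {α : ℝ} (hα : 0 < α) (γ c c' : ℝ) :
    stableExponent α γ c c' 0 = 0 := by
  simp [stableExponent, Real.zero_rpow hα.ne']

theorem norm_exp_stableExponent (α γ c c' t : ℝ) :
    ‖Complex.exp (stableExponent α γ c c' t)‖ = Real.exp (-(c * |t| ^ α)) := by
  rw [Complex.norm_exp]
  congr 1
  rw [stableExponent]
  simp only [← Complex.ofReal_mul, Complex.sub_re, Complex.mul_re]
  simp

theorem HasStableRepresentation.pos {μ : Measure ℝ} [IsProbabilityMeasure μ]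
    (hμ : ¬ IsDegenerate μ) {α γ c c' : ℝ} (h : HasStableRepresentation μ α γ c c') : 0 < c := by
  have h1 : 0 ≤ c := by
    have := norm_charFun_le_one (μ := μ) (t := (1 : ℝ))
    rw [h, norm_exp_stableExponent, Real.exp_le_one_iff] at this
    simpa using this
  refine h1.lt_of_ne fun h0 => hμ (isDegenerate_of_norm_charFun_eq_one μ fun t => ?_)
  rw [h, norm_exp_stableExponent, ← h0]
  simp

theorem exists_hasStableRepresentation (μ : Measure ℝ) [IsProbabilityMeasure μ]
    (hμ : ¬ IsDegenerate μ) {α : ℝ} (h : IsStableWithIndex μ α) (hα1 : α ≠ 1) :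
    ∃ γ c c' : ℝ, HasStableRepresentation μ α γ c c' := by
  obtain ⟨hα, a, b, hab, ha⟩ := h
  have hs : IsStableWith μ (fun n => (n : ℝ) ^ (1 / α)) b := fun n hn => by
    simpa only [ha n hn] using hab n hn
  obtain ⟨ψ, hc, he, hneg, hsc⟩ := exists_log_scaling hα hs
  obtain ⟨γ, hγ⟩ := exists_centering_of_log_scaling hα hα1 hsc
  have hw : ∀ t : ℝ, 0 < t → ψ t - Complex.I * γ * t
      = ((t ^ α : ℝ) : ℂ) * (ψ 1 - Complex.I * γ * (1 : ℝ)) := fun t ht =>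
    eq_rpow_mul_of_nat_scaling (w := fun t : ℝ => ψ t - Complex.I * γ * t) (by fun_prop) hα
      (fun n hn t => by
        have := hsc n hn t
        rw [hγ n hn] at this
        push_cast at this ⊢
        linear_combination this) ht
  have h0 : ψ 0 = 0 := by
    have := hsc 2 (by norm_num) 0
    simp at this
    linear_combination this
  set w := ψ 1 - Complex.I * γ * (1 : ℝ) with hwdef
  have hre : w.re ≠ 0 := by
    intro hw0
    have hpos : ∀ t : ℝ, 0 < t → ‖charFun μ t‖ = 1 := fun t ht => by
      rw [← he, Complex.norm_exp, show ψ t = ((t ^ α : ℝ) : ℂ) * w + Complex.I * γ * t by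
        linear_combination hw t ht, Complex.add_re, Complex.re_ofReal_mul, hw0]
      simp
    refine hμ (isDegenerate_of_norm_charFun_eq_one μ fun t => ?_)
    rcases lt_trichotomy t 0 with ht | rfl | ht
    · have := hpos (-t) (by linarith)
      rwa [charFun_neg, RCLike.norm_conj] at this
    · simp
    · exact hpos t ht
  -- Solves `w = -c (1 - i c')`.
  refine ⟨γ, -w.re, w.im / -w.re, fun t => ?_⟩
  rw [← he]
  congr 1
  have hpos : ∀ t : ℝ, 0 < t → ψ t = stableExponent α γ (-w.re) (w.im / -w.re) t := by
    intro t ht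
    rw [stableExponent_of_pos ht]
    have hrc : (w.re : ℂ) ≠ 0 := by exact_mod_cast hre
    have e := Complex.re_add_im w
    have := hw t ht
    rw [← e] at this
    push_cast
    field_simp
    linear_combination this
  rcases lt_trichotomy t 0 with ht | rfl | ht
  · have := hpos (-t) (by linarith)
    rw [hneg, stableExponent_neg] at this
    exact (starRingEnd ℂ).injective this
  · rw [h0, stableExponent_zero hα]
  · exact hpos t ht

/-! ### Laplace transform of a power -/

theorem integrableOn_rpow_mul_exp_neg_mul {α ε : ℝ} (hα : -1 < α) (hε : 0 < ε) :
    IntegrableOn (fun t : ℝ => t ^ α * Real.exp (-(ε * t))) (Set.Ioi 0) := by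
  simpa using integrableOn_rpow_mul_exp_neg_mul_rpow hα one_pos hε

/-- The Laplace transform of `t ^ α`, at a complex argument with positive real part. -/
theorem integral_rpow_mul_cexp_neg_mul_Ioi {α : ℝ} (hα : -1 < α) {r : ℂ} (hr : 0 < r.re) :
    ∫ t in Set.Ioi (0 : ℝ), ((t ^ α : ℝ) : ℂ) * Complex.exp (-(r * t))
      = Real.Gamma (α + 1) * r ^ (-((α : ℂ) + 1)) := by
  set ν : Measure ℝ := (volume.restrict (Set.Ioi 0)).withDensity fun t => ENNReal.ofReal (t ^ α)
    with hν
  have hm : Measurable fun t : ℝ => ENNReal.ofReal (t ^ α) := by fun_prop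
  have hI : ∀ z : ℂ, ProbabilityTheory.complexMGF id ν z
      = ∫ t in Set.Ioi (0 : ℝ), ((t ^ α : ℝ) : ℂ) * Complex.exp (z * t) := by
    intro z
    rw [ProbabilityTheory.complexMGF, hν, integral_withDensity_eq_integral_toReal_smul hm (by simp)]
    refine setIntegral_congr_fun measurableSet_Ioi fun t ht => ?_
    simp only [id]
    rw [ENNReal.toReal_ofReal (Real.rpow_nonneg (le_of_lt ht) _), Complex.real_smul]
  have hint : Set.Iio 0 ⊆ ProbabilityTheory.integrableExpSet id ν := by
    intro s hs
    show Integrable _ ν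
    rw [hν, integrable_withDensity_iff hm (by simp)]
    refine (integrableOn_rpow_mul_exp_neg_mul hα (neg_pos.2 hs)).congr_fun (fun t ht => ?_)
      measurableSet_Ioi
    simp only [id]
    rw [ENNReal.toReal_ofReal (Real.rpow_nonneg (le_of_lt ht) _)]
    ring_nf
  have hsub : Set.Iio 0 ⊆ interior (ProbabilityTheory.integrableExpSet id ν) :=
    interior_maximal hint isOpen_Iio
  have hf : AnalyticOnNhd ℂ (ProbabilityTheory.complexMGF id ν) {z | z.re < 0} :=
    ProbabilityTheory.analyticOnNhd_complexMGF.mono fun z hz => hsub hz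
  have hopen : IsOpen {z : ℂ | z.re < 0} := isOpen_lt Complex.continuous_re continuous_const
  have hg : AnalyticOnNhd ℂ (fun z : ℂ => Real.Gamma (α + 1) * (-z) ^ (-((α : ℂ) + 1)))
      {z | z.re < 0} := by
    refine DifferentiableOn.analyticOnNhd (fun z hz => ?_) hopen
    have : -z ∈ Complex.slitPlane := Or.inl (by simpa using hz)
    exact ((differentiableAt_id.neg.cpow_const this).const_mul _).differentiableWithinAt
  -- Identity theorem on the left half-plane: both sides agree at negative reals, by the real Gamma
  -- integral, and these accumulate at `-1`.
  have hconv : IsPreconnected {z : ℂ | z.re < 0} := (convex_halfSpace_re_lt 0).isPreconnected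
  have hfreq : ∃ᶠ z in nhdsWithin (-1 : ℂ) {-1}ᶜ, ProbabilityTheory.complexMGF id ν z
      = Real.Gamma (α + 1) * (-z) ^ (-((α : ℂ) + 1)) := by
    have ht : Filter.Tendsto (fun x : ℝ => (x : ℂ)) (nhdsWithin (-1) {-1}ᶜ)
        (nhdsWithin (-1 : ℂ) {-1}ᶜ) := by
      refine tendsto_nhdsWithin_iff.2 ⟨?_, ?_⟩
      · have := (Complex.continuous_ofReal.tendsto (-1)).mono_left
          (nhdsWithin_le_nhds (s := {(-1 : ℝ)}ᶜ))
        simpa using this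
      · filter_upwards [self_mem_nhdsWithin] with x hx
        simp only [Set.mem_compl_iff, Set.mem_singleton_iff] at hx ⊢
        exact_mod_cast hx
    refine ht.frequently (Filter.Eventually.frequently ?_)
    filter_upwards [nhdsWithin_le_nhds (Iio_mem_nhds (by norm_num : (-1 : ℝ) < 0))] with x hx
    rw [hI]
    have hx' : 0 < -x := neg_pos.2 hx
    have e := Real.integral_rpow_mul_exp_neg_mul_Ioi (a := α + 1) (by linarith) hx'
    rw [add_sub_cancel_right, one_div, Real.inv_rpow hx'.le, ← Real.rpow_neg hx'.le, mul_comm] at e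
    have e' := congrArg (fun y : ℝ => (y : ℂ)) e
    simp only [Complex.ofReal_mul, Complex.ofReal_cpow hx'.le] at e'
    push_cast at e'
    rw [← e', ← integral_complex_ofReal]
    refine integral_congr_ae (.of_forall fun t => ?_)
    simp
  have := hf.eqOn_of_preconnected_of_frequently_eq hg hconv (by simp) hfreq
    (show -r ∈ {z : ℂ | z.re < 0} by simpa using hr)
  simp only [neg_neg] at this
  rw [← this, hI]
  simp only [neg_mul]

/-! ### Positivity in the upper half-plane -/

theorem re_I_mul_mul_ofReal (p : ℂ) (t : ℝ) : (Complex.I * p * t).re = -(p.im * t) := by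
  simp

/-- The expression equals `x² Im p / |p - x|²`. -/
theorem im_add_sq_mul_inv_nonneg {p : ℂ} (hp : 0 < p.im) (x : ℝ) :
    0 ≤ p.im + (p ^ 2 * (-1 / (Complex.I * (p - x)))).re := by
  have hne : p - x ≠ 0 := fun h => by
    have := congrArg Complex.im h
    simp at this
    exact hp.ne' this
  have hns : 0 < Complex.normSq (p - x) := Complex.normSq_pos.2 hne
  have e : p.im + (p ^ 2 * (-1 / (Complex.I * (p - x)))).re
      = x ^ 2 * p.im / Complex.normSq (p - x) := by
    have h1 : -1 / (Complex.I * (p - x)) = Complex.I / (p - x) := by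
      field_simp
      simp
    rw [h1, eq_div_iff hns.ne', div_eq_mul_inv, Complex.inv_def]
    simp only [Complex.mul_re, Complex.mul_im, pow_two, Complex.I_re, Complex.I_im,
      Complex.conj_re, Complex.conj_im, Complex.ofReal_re, Complex.ofReal_im, Complex.sub_re,
      Complex.sub_im]
    have h2 : Complex.normSq (p - x) = (p.re - x) ^ 2 + p.im ^ 2 := by
      simp [Complex.normSq_apply, pow_two]
    rw [h2] at hns ⊢
    field_simp
    ring
  rw [e]
  positivity

theorem re_I_mul_sub {p : ℂ} (x : ℝ) : (Complex.I * (p - x)).re = -p.im := by simp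

/-- Fubini, with integrable majorant `exp(-t Im p)`. -/
theorem integral_cexp_mul_charFun_neg (ν : Measure ℝ) [IsProbabilityMeasure ν] {p : ℂ}
    (hp : 0 < p.im) :
    ∫ t in Set.Ioi (0 : ℝ), Complex.exp (Complex.I * p * t) * charFun ν (-t)
      = ∫ x, -1 / (Complex.I * (p - x)) ∂ν := by
  have h1 : ∀ t : ℝ, Complex.exp (Complex.I * p * t) * charFun ν (-t)
      = ∫ x, Complex.exp (Complex.I * (p - x) * t) ∂ν := by
    intro t
    rw [charFun_apply_real, ← integral_const_mul]
    refine integral_congr_ae (.of_forall fun x => ?_)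
    simp only
    rw [← Complex.exp_add]
    congr 1
    push_cast
    ring
  simp_rw [h1]
  rw [integral_integral_swap]
  · refine integral_congr_ae (.of_forall fun x => ?_)
    simp only
    rw [integral_exp_mul_complex_Ioi (by rw [re_I_mul_sub]; linarith)]
    simp
  · have hg : Integrable (fun z : ℝ × ℝ => Real.exp (-p.im * z.1) * 1)
        ((volume.restrict (Set.Ioi 0)).prod ν) :=
      (integrableOn_exp_mul_Ioi (by linarith) 0).mul_prod (integrable_const 1)
    refine hg.mono' (by
      apply Continuous.aestronglyMeasurable
      unfold Function.uncurry
      fun_prop) (.of_forall fun z => ?_)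
    simp only [Function.uncurry]
    rw [Complex.norm_exp, Complex.re_mul_ofReal, re_I_mul_sub, mul_one]

theorem integrable_neg_one_div (ν : Measure ℝ) [IsProbabilityMeasure ν] {p : ℂ}
    (hp : 0 < p.im) : Integrable (fun x : ℝ => -1 / (Complex.I * (p - x))) ν := by
  have hne : ∀ x : ℝ, Complex.I * (p - x) ≠ 0 := fun x h => by
    have := congrArg Complex.re h
    rw [re_I_mul_sub] at this
    simp at this
    exact hp.ne' this
  refine Integrable.of_bound (C := 1 / p.im) ?_ (.of_forall fun x => ?_)
  · exact (continuous_const.div (by fun_prop) hne).aestronglyMeasurable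
  · rw [norm_div, norm_neg, norm_one]
    refine one_div_le_one_div_of_le hp ?_
    have := Complex.abs_re_le_norm (Complex.I * (p - x))
    rwa [re_I_mul_sub, abs_neg, abs_of_pos hp] at this

/-- Positivity of the mean of `Im p * x ^ 2 / |x - p| ^ 2`, in terms of the characteristic
function. -/
theorem im_add_sq_mul_integral_charFun_nonneg (ν : Measure ℝ) [IsProbabilityMeasure ν] {p : ℂ}
    (hp : 0 < p.im) :
    0 ≤ p.im + (p ^ 2 *
      ∫ t in Set.Ioi (0 : ℝ), Complex.exp (Complex.I * p * t) * charFun ν (-t)).re := by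
  have hi := (integrable_neg_one_div ν hp).const_mul (p ^ 2)
  have e : p.im + (p ^ 2 *
      ∫ t in Set.Ioi (0 : ℝ), Complex.exp (Complex.I * p * t) * charFun ν (-t)).re
      = ∫ x, (p.im + (p ^ 2 * (-1 / (Complex.I * (p - (x : ℂ))))).re) ∂ν := by
    rw [integral_add (integrable_const _) (by exact hi.re), integral_cexp_mul_charFun_neg ν hp,
      ← integral_const_mul]
    congr 1
    · simp
    · exact (integral_re hi).symm
  rw [e]
  exact integral_nonneg fun x => im_add_sq_mul_inv_nonneg hp x

/-! ### Rescaling, limit and boundary values -/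

theorem norm_exp_sub_one_le_of_re_nonpos {z : ℂ} (hz : z.re ≤ 0) :
    ‖Complex.exp z - 1‖ ≤ ‖z‖ := by
  have := (convex_halfSpace_re_le 0).norm_image_sub_le_of_norm_deriv_le (f := Complex.exp)
    (C := 1) (x := 0) (y := z) (fun w _ => Complex.differentiableAt_exp) (fun w hw => by
      rw [Complex.deriv_exp, Complex.norm_exp, Real.exp_le_one_iff]; exact hw) (by simp) hz
  simpa using this

theorem HasStableRepresentation.rescaled_nonneg {μ : Measure ℝ} [IsProbabilityMeasure μ]
    {α γ c c' : ℝ} (h : HasStableRepresentation μ α γ c c') (hα : 0 < α) {p : ℂ}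
    (hp : 0 < p.im) {n : ℕ} (hn : 1 ≤ n) :
    0 ≤ (p ^ 2 * ∫ t in Set.Ioi (0 : ℝ), Complex.exp (Complex.I * p * t) *
      (n * (Complex.exp (-(c * (1 + Complex.I * c') * ((t ^ α : ℝ) : ℂ)) / n) - 1))).re := by
  have hn0 : (0 : ℝ) < n := by exact_mod_cast hn
  set a : ℝ := (n : ℝ) ^ (-(1 / α)) with ha
  have ha0 : 0 < a := Real.rpow_pos_of_pos hn0 _
  have haα : a ^ α = 1 / n := by
    rw [ha, ← Real.rpow_mul hn0.le, show -(1 / α) * α = -1 by field_simp, Real.rpow_neg_one,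
      one_div]
  -- The law of `n^(-1/α) (X - γ)`: centering removes the drift and scaling divides the exponent by
  -- `n`.
  set ν : Measure ℝ := μ.map fun x => a * x + -(a * γ)
  have : IsProbabilityMeasure ν := Measure.isProbabilityMeasure_map (by fun_prop)
  have hch : ∀ t ∈ Set.Ioi (0 : ℝ), charFun ν (-t)
      = Complex.exp (-(c * (1 + Complex.I * c') * ((t ^ α : ℝ) : ℂ)) / n) := by
    intro t ht
    have ht : 0 < t := ht
    rw [charFun_map_affine, mul_neg, h, stableExponent_neg, stableExponent_of_pos (by positivity),
      Real.mul_rpow ha0.le ht.le, haα, ← Complex.exp_add]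
    congr 1
    simp only [map_sub, map_mul, Complex.conj_I, Complex.conj_ofReal, map_one]
    push_cast
    ring
  have hI1 := integrableOn_exp_mul_complex_Ioi (a := Complex.I * p) (by simpa using hp) 0
  have hI2 : IntegrableOn (fun t : ℝ => Complex.exp (Complex.I * p * t) * charFun ν (-t))
      (Set.Ioi 0) := by
    refine Integrable.mono hI1 ?_ (.of_forall fun t => ?_)
    · exact (Continuous.mul (by fun_prop)
        ((continuous_charFun (μ := ν)).comp continuous_neg)).aestronglyMeasurable
    · rw [norm_mul]
      exact mul_le_of_le_one_right (norm_nonneg _) (norm_charFun_le_one _)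
  have key := im_add_sq_mul_integral_charFun_nonneg ν hp
  have e : ∫ t in Set.Ioi (0 : ℝ), Complex.exp (Complex.I * p * t) *
      (n * (Complex.exp (-(c * (1 + Complex.I * c') * ((t ^ α : ℝ) : ℂ)) / n) - 1))
      = n * ((∫ t in Set.Ioi (0 : ℝ), Complex.exp (Complex.I * p * t) * charFun ν (-t))
        - ∫ t in Set.Ioi (0 : ℝ), Complex.exp (Complex.I * p * t)) := by
    rw [← integral_sub hI2 hI1, ← integral_const_mul]
    refine setIntegral_congr_fun measurableSet_Ioi fun t ht => ?_
    rw [hch t ht]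
    ring
  have hp0 : p ≠ 0 := fun h0 => by simp [h0] at hp
  -- Its real part `-Im p` cancels the constant term, so multiplying by `n` keeps a finite limit.
  have e2 : p ^ 2 * ∫ t in Set.Ioi (0 : ℝ), Complex.exp (Complex.I * p * t) = Complex.I * p := by
    rw [integral_exp_mul_complex_Ioi (by simpa using hp)]
    have := Complex.I_sq
    field_simp
    simp [this]
  rw [e, mul_left_comm, mul_sub, e2, ← Complex.ofReal_natCast, Complex.re_ofReal_mul]
  refine mul_nonneg hn0.le ?_
  rw [Complex.sub_re]
  simp only [Complex.mul_re, Complex.I_re, Complex.I_im] at key ⊢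
  linarith

/-- The limit of `HasStableRepresentation.rescaled_nonneg` as `n → ∞`. -/
theorem HasStableRepresentation.re_gamma_nonpos {μ : Measure ℝ} [IsProbabilityMeasure μ]
    {α γ c c' : ℝ} (h : HasStableRepresentation μ α γ c c') (hα : 0 < α) (hc : 0 < c) {p : ℂ}
    (hp : 0 < p.im) :
    (p ^ 2 * (1 + Complex.I * c') * (-(Complex.I * p)) ^ (-((α : ℂ) + 1))).re ≤ 0 := by
  set K : ℂ := c * (1 + Complex.I * c') with hK
  have hKre : 0 ≤ K.re := by simp [hK, hc.le]
  have hlim : Filter.Tendsto (fun n : ℕ => ∫ t in Set.Ioi (0 : ℝ), Complex.exp (Complex.I * p * t) *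
      (n * (Complex.exp (-(K * ((t ^ α : ℝ) : ℂ)) / n) - 1))) Filter.atTop
      (nhds (∫ t in Set.Ioi (0 : ℝ), Complex.exp (Complex.I * p * t) *
        (-(K * ((t ^ α : ℝ) : ℂ))))) := by
    refine tendsto_integral_of_dominated_convergence
      (fun t => ‖K‖ * (t ^ α * Real.exp (-(p.im * t)))) (fun n => ?_)
      ((integrableOn_rpow_mul_exp_neg_mul (by linarith) hp).const_mul _) (fun n => ?_) ?_
    · exact Measurable.aestronglyMeasurable (by fun_prop)
    · filter_upwards [ae_restrict_mem measurableSet_Ioi] with t ht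
      have htα : 0 ≤ t ^ α := Real.rpow_nonneg (le_of_lt ht) _
      rw [norm_mul, Complex.norm_exp, re_I_mul_mul_ofReal]
      rcases Nat.eq_zero_or_pos n with rfl | hn
      · simp only [Nat.cast_zero, zero_mul, norm_zero, mul_zero]
        positivity
      · have hn' : (0 : ℝ) < n := by exact_mod_cast hn
        have h1 := norm_exp_sub_one_le_of_re_nonpos (z := -(K * ((t ^ α : ℝ) : ℂ)) / n) (by
          rw [← Complex.ofReal_natCast, Complex.div_ofReal_re, Complex.neg_re,
            Complex.re_mul_ofReal]
          exact div_nonpos_of_nonpos_of_nonneg (by nlinarith [mul_nonneg hKre htα]) hn'.le)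
        rw [norm_div, norm_neg, norm_mul, Complex.norm_real, Real.norm_of_nonneg htα,
          Complex.norm_natCast, le_div_iff₀ hn'] at h1
        rw [norm_mul, Complex.norm_natCast]
        nlinarith [mul_le_mul_of_nonneg_left h1 (Real.exp_pos (-(p.im * t))).le]
    · refine .of_forall fun t => Filter.Tendsto.const_mul _ ?_
      set z : ℂ := -(K * ((t ^ α : ℝ) : ℂ))
      have hd : HasDerivAt (fun s : ℝ => Complex.exp (s * z)) z 0 := by
        have h1 : HasDerivAt (fun s : ℂ => Complex.exp (s * z)) z ((0 : ℝ) : ℂ) := by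
          simpa using (((hasDerivAt_id (0 : ℂ)).mul_const z).cexp)
        exact h1.comp_ofReal
      -- The factor `n (exp(z/n) - 1)` is the difference quotient of `s ↦ exp(s z)` at step `s =
      -- 1/n`.
      have h2 := hd.tendsto_slope_zero_right.comp
        (tendsto_nhdsWithin_iff.2 ⟨tendsto_inv_atTop_nhds_zero_nat (𝕜 := ℝ), by
          filter_upwards [Filter.eventually_gt_atTop 0] with n hn
          simpa using hn⟩)
      refine h2.congr fun n => ?_
      simp [div_eq_mul_inv, mul_comm]
  have hlim' := (Complex.continuous_re.tendsto _).comp (hlim.const_mul (p ^ 2))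
  have hge := ge_of_tendsto hlim' (Filter.eventually_atTop.2 ⟨1, fun n hn =>
    h.rescaled_nonneg hα hp hn⟩)
  have hval : ∫ t in Set.Ioi (0 : ℝ), Complex.exp (Complex.I * p * t) * (-(K * ((t ^ α : ℝ) : ℂ)))
      = -K * (Real.Gamma (α + 1) * (-(Complex.I * p)) ^ (-((α : ℂ) + 1))) := by
    rw [← integral_rpow_mul_cexp_neg_mul_Ioi (by linarith) (by simpa using hp),
      ← integral_const_mul]
    refine integral_congr_ae (.of_forall fun t => ?_)
    simp only [neg_mul, neg_neg]
    ring
  rw [hval, hK] at hge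
  have hG : 0 < Real.Gamma (α + 1) := Real.Gamma_pos_of_pos (by linarith)
  rw [show p ^ 2 * (-(c * (1 + Complex.I * c')) *
        (Real.Gamma (α + 1) * (-(Complex.I * p)) ^ (-((α : ℂ) + 1))))
      = ((-(c * Real.Gamma (α + 1)) : ℝ) : ℂ) *
        (p ^ 2 * (1 + Complex.I * c') * (-(Complex.I * p)) ^ (-((α : ℂ) + 1))) by
      push_cast; ring, Complex.re_ofReal_mul] at hge
  have : 0 < c * Real.Gamma (α + 1) := mul_pos hc hG
  nlinarith

/-- The boundary values of `HasStableRepresentation.re_gamma_nonpos` on the real axis. -/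
theorem HasStableRepresentation.re_gamma_nonpos_real {μ : Measure ℝ} [IsProbabilityMeasure μ]
    {α γ c c' : ℝ} (h : HasStableRepresentation μ α γ c c') (hα : 0 < α) (hc : 0 < c) {s : ℝ}
    (hs : s ≠ 0) :
    (s ^ 2 * (1 + Complex.I * c') * (-(Complex.I * s)) ^ (-((α : ℂ) + 1))).re ≤ 0 := by
  -- For `s ≠ 0` the base `-is` is off the branch cut, so the power is continuous there.
  have hsl : -(Complex.I * (s + Complex.I * (0 : ℝ))) ∈ Complex.slitPlane := by
    right; simpa using hs
  have hcont : ContinuousAt (fun ε : ℝ => ((s + Complex.I * ε) ^ 2 * (1 + Complex.I * c') *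
      (-(Complex.I * (s + Complex.I * ε))) ^ (-((α : ℂ) + 1))).re) 0 := by
    refine Complex.continuous_re.continuousAt.comp (ContinuousAt.mul (by fun_prop) ?_)
    exact ContinuousAt.cpow (by fun_prop) continuousAt_const hsl
  have ht := hcont.tendsto.mono_left (nhdsWithin_le_nhds (s := Set.Ioi 0))
  have := le_of_tendsto ht (by
    filter_upwards [self_mem_nhdsWithin] with ε hε
    exact h.re_gamma_nonpos hα hc (p := s + Complex.I * ε) (by simpa using hε))
  simpa using this

theorem HasStableRepresentation.abs_mul_cos_le_sin {μ : Measure ℝ} [IsProbabilityMeasure μ]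
    {α γ c c' : ℝ} (h : HasStableRepresentation μ α γ c c') (hα : 0 < α) (hc : 0 < c) :
    |c' * Real.cos (Real.pi * α / 2)| ≤ Real.sin (Real.pi * α / 2) := by
  have e1 : (-Complex.I) ^ (-((α : ℂ) + 1))
      = ((-Real.sin (Real.pi * α / 2) : ℝ) : ℂ) + (Real.cos (Real.pi * α / 2) : ℝ) * Complex.I := by
    rw [Complex.cpow_def_of_ne_zero (by simp), Complex.log_neg_I,
      show -(↑Real.pi / 2) * Complex.I * -((α : ℂ) + 1)
        = ((Real.pi * α / 2 + Real.pi / 2 : ℝ) : ℂ) * Complex.I by push_cast; ring,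
      Complex.exp_mul_I, ← Complex.ofReal_cos, ← Complex.ofReal_sin, Real.cos_add_pi_div_two,
      Real.sin_add_pi_div_two]
  have e2 : Complex.I ^ (-((α : ℂ) + 1))
      = ((-Real.sin (Real.pi * α / 2) : ℝ) : ℂ)
        + (-Real.cos (Real.pi * α / 2) : ℝ) * Complex.I := by
    rw [Complex.cpow_def_of_ne_zero (by simp), Complex.log_I,
      show ↑Real.pi / 2 * Complex.I * -((α : ℂ) + 1)
        = ((-(Real.pi * α / 2 + Real.pi / 2) : ℝ) : ℂ) * Complex.I by push_cast; ring,
      Complex.exp_mul_I, ← Complex.ofReal_cos, ← Complex.ofReal_sin, Real.cos_neg, Real.sin_neg,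
      Real.cos_add_pi_div_two, Real.sin_add_pi_div_two]
  -- The boundary points `1` and `-1` give the two signs: `-sin - c' cos ≤ 0` and `-sin + c' cos ≤
  -- 0`.
  have h1 := h.re_gamma_nonpos_real hα hc (s := 1) one_ne_zero
  have h2 := h.re_gamma_nonpos_real hα hc (s := -1) (by norm_num)
  simp only [Complex.ofReal_one, mul_one, one_pow, one_mul] at h1
  simp only [Complex.ofReal_neg, Complex.ofReal_one, mul_neg, mul_one, neg_neg, even_two,
    Even.neg_pow, one_pow, one_mul] at h2
  rw [e1] at h1
  rw [e2] at h2
  simp only [Complex.mul_re, Complex.add_re, Complex.add_im, Complex.mul_im, Complex.ofReal_re,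
    Complex.ofReal_im, Complex.I_re, Complex.I_im, Complex.one_re, Complex.one_im] at h1 h2
  rw [abs_le]
  constructor <;> linarith

theorem lemma4p6 (μ : Measure ℝ) [IsProbabilityMeasure μ] (hμ : ¬ IsDegenerate μ)
    (α : ℝ) (hα : IsStableWithIndex μ α) (hα1 : α ≠ 1) :
    (∃ γ c c' : ℝ, 0 < c ∧ HasStableRepresentation μ α γ c c') ∧
    ∀ γ c c' : ℝ, HasStableRepresentation μ α γ c c' →
      0 < c ∧
      (α < 2 → ∃ β : ℝ, -1 ≤ β ∧ β ≤ 1 ∧ c' = β * Real.tan (Real.pi * α / 2)) ∧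
      (α = 2 → c' = 0) := by
  refine ⟨?_, fun γ c c' h => ⟨h.pos hμ, fun hα2 => ?_, fun hα2 => ?_⟩⟩
  · obtain ⟨γ, c, c', h⟩ := exists_hasStableRepresentation μ hμ hα hα1
    exact ⟨γ, c, c', h.pos hμ, h⟩
  · have hle := abs_le.1 (h.abs_mul_cos_le_sin hα.1 (h.pos hμ))
    have hα0 := hα.1
    have hsin : 0 < Real.sin (Real.pi * α / 2) :=
      Real.sin_pos_of_pos_of_lt_pi (by positivity) (by nlinarith [Real.pi_pos])
    -- On `0 < α < 2` the cosine vanishes only at `α = 1`.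
    have hcos : Real.cos (Real.pi * α / 2) ≠ 0 := by
      intro h0
      obtain ⟨k, hk⟩ := Real.cos_eq_zero_iff.1 h0
      have hk' : α = 2 * k + 1 := by
        have := Real.pi_pos.ne'
        field_simp at hk
        linarith
      have h1 : (-1 : ℝ) < k := by linarith
      have h2 : (k : ℝ) < 1 := by linarith
      have h3 : -1 < k := by exact_mod_cast h1
      have h4 : k < 1 := by exact_mod_cast h2
      have : k = 0 := by omega
      exact hα1 (by rw [hk', this]; simp)
    refine ⟨c' * Real.cos (Real.pi * α / 2) / Real.sin (Real.pi * α / 2), ?_, ?_, ?_⟩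
    · rw [le_div_iff₀ hsin]; linarith
    · rw [div_le_iff₀ hsin]; linarith
    · rw [Real.tan_eq_sin_div_cos]
      field_simp
  -- At `α = 2` the bound reads `|c' cos π| ≤ sin π = 0`.
  · have hle := h.abs_mul_cos_le_sin hα.1 (h.pos hμ)
    rw [hα2, show Real.pi * 2 / 2 = Real.pi by ring] at hle
    simpa using hle
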